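/- **Conventions.** Graphs are simple. For a graph $\Gamma$ with vertex set $V(\Gamma)$ and edge set $E(\Gamma)$, the right-angled Artin group on $\Gamma$ is $$A(\Gamma)=\langle V(\Gamma)\mid uvu^{-1}v^{-1}=1 \text{ whenever } \{u,v\}\in E(\Gamma)\rangle .$$ A word in the letters $V(\Gamma)\cup V(\Gamma)^{-1}$ is reduced if no word with fewer letters represents the same element of $A(\Gamma)$. For $g\in A(\Gamma)$, the support $\mathrm{supp}(g)\subseteq V(\Gamma)$ is the set of vertices $v$ such that $v$ or $v^{-1}$ occurs in a reduced word representing $g$ (this set does not depend on the reduced word). A homomorphism $\psi\colon A(\Lambda)\to A(\Gamma)$ satisfies the (KK) condition if, for every $v\in V(\Lambda)$, the vertices in $\mathrm{supp}(\psi(v))$ are mutually adjacent in $\Gamma$; put $\mathrm{supp}(\psi)=\bigcup_{v\in V(\Lambda)}\mathrm{supp}(\psi(v))$. The path graph on $n\ge 1$ vertices is denoted $P_n$, and $P_n^c$ is its complement. The join of graphs $\Lambda_1,\dots,\Lambda_m$ is obtained from their disjoint union by adding all edges between vertices of $\Lambda_i$ and $\Lambda_j$ for $i\ne j$. A full embedding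 $\iota\colon\Lambda\to\Gamma$ is an injective map $V(\Lambda)\to V(\Gamma)$ such that $u,v$ are adjacent in $\Lambda$ if and only if $\iota(u),\iota(v)$ are adjacent in $\Gamma$. **Lemma 4.5.** Let $\Lambda$ be the join of the complements $P_{n_1}^c,\dots,P_{n_m}^c$ of finitely many path graphs ($n_i\ge 1$), and let $\Gamma$ be a finite graph. Suppose that $\psi\colon A(\Lambda)\to A(\Gamma)$ is an injective homomorphism satisfying the (KK) condition. Then there is a full embedding $\iota\colon\Lambda\to\Gamma$ with $\iota(V(\Lambda))\subseteq\mathrm{supp}(\psi)$. -/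

import Mathlib

/-- The defining relators `u v u⁻¹ v⁻¹`, one for each ordered pair of adjacent vertices. -/
def raagRels {V : Type*} (G : SimpleGraph V) : Set (FreeGroup V) :=
  {r | ∃ u v : V, G.Adj u v ∧
    r = FreeGroup.of u * FreeGroup.of v * (FreeGroup.of u)⁻¹ * (FreeGroup.of v)⁻¹}

/-- The right-angled Artin group `A(G)`. -/
abbrev RAAG {V : Type*} (G : SimpleGraph V) : Type _ := PresentedGroup (raagRels G)

namespace RAAG

/-- The generator of `A(G)` given by a vertex. -/
def vert {V : Type*} (G : SimpleGraph V) (v : V) : RAAG G := PresentedGroup.of v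

/-- The element of `A(G)` represented by a word. A word is a list of letters; the letter
`(v, true)` stands for `v` and the letter `(v, false)` for `v⁻¹`. -/
def wordVal {V : Type*} (G : SimpleGraph V) (w : List (V × Bool)) : RAAG G :=
  PresentedGroup.mk (raagRels G) (FreeGroup.mk w)

/-- A word is reduced if no word representing the same element of `A(G)` has fewer letters. -/
def IsReducedWord {V : Type*} (G : SimpleGraph V) (w : List (V × Bool)) : Prop :=
  ∀ w' : List (V × Bool), wordVal G w' = wordVal G w → w.length ≤ w'.length

/-- The set of vertices `v` such that the letter `v` or `v⁻¹` occurs in a word. -/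
def wordSupp {V : Type*} (w : List (V × Bool)) : Set V := {v | ∃ ε : Bool, (v, ε) ∈ w}

/-- The support of an element `g` of `A(G)`: the vertices occurring, with exponent `1` or `-1`, in
a reduced word for `g`. All reduced words for `g` give the same set, see
`RAAG.supp_eq_wordSupp`. -/
def supp {V : Type*} {G : SimpleGraph V} (g : RAAG G) : Set V :=
  {v | ∃ w : List (V × Bool), IsReducedWord G w ∧ wordVal G w = g ∧ v ∈ wordSupp w}

/-- Every element is represented by a reduced word. -/
theorem exists_reducedWord {V : Type*} {G : SimpleGraph V} (g : RAAG G) :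
    ∃ w : List (V × Bool), IsReducedWord G w ∧ wordVal G w = g := by
  classical
  have hne : ∃ n : ℕ, ∃ w : List (V × Bool), wordVal G w = g ∧ w.length = n := by
    obtain ⟨x, rfl⟩ := PresentedGroup.mk_surjective (raagRels G) g
    exact ⟨_, x.toWord, by rw [wordVal, FreeGroup.mk_toWord], rfl⟩
  obtain ⟨w, hw, hl⟩ := Nat.find_spec hne
  refine ⟨w, fun w' hw' => ?_, hw⟩
  rw [hl]
  exact Nat.find_min' hne ⟨w', hw'.trans hw, rfl⟩

open Classical in
/-- The endomorphism of `A(G)` that kills one generator and fixes the others. -/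
noncomputable def killVertex {V : Type*} (G : SimpleGraph V) (v : V) : RAAG G →* RAAG G :=
  PresentedGroup.toGroup (f := fun u => if u = v then 1 else vert G u) (by
    rintro r ⟨a, b, hab, rfl⟩
    have hc : vert G a * vert G b * (vert G a)⁻¹ * (vert G b)⁻¹ = 1 :=
      PresentedGroup.one_of_mem (rels := raagRels G) ⟨a, b, hab, rfl⟩
    simp only [map_mul, map_inv, FreeGroup.lift_apply_of]
    by_cases ha : a = v <;> by_cases hb : b = v <;> simp [ha, hb]
    simpa using hc)

open Classical in
theorem killVertex_wordVal {V : Type*} (G : SimpleGraph V) (v : V) (w : List (V × Bool)) :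
    killVertex G v (wordVal G w) = wordVal G (w.filter fun l => l.1 ≠ v) := by
  have hcons : ∀ (l : V × Bool) (w : List (V × Bool)),
      wordVal G (l :: w) = wordVal G [l] * wordVal G w := by
    intro l w
    simp only [wordVal]
    rw [← map_mul, FreeGroup.mul_mk, List.singleton_append]
  have hsing : ∀ l : V × Bool, killVertex G v (wordVal G [l]) =
      if l.1 = v then 1 else wordVal G [l] := by
    rintro ⟨u, ε⟩
    have hu : killVertex G v (vert G u) = if u = v then 1 else vert G u := by
      exact PresentedGroup.toGroup.of _
    cases ε
    · have h1 : wordVal G [(u, false)] = (vert G u)⁻¹ := by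
        simp [wordVal, vert, PresentedGroup.of, FreeGroup.of, ← map_inv, FreeGroup.inv_mk,
          FreeGroup.invRev]
      rw [h1, map_inv, hu]
      by_cases h : u = v <;> simp [h]
    · exact hu
  induction w with
  | nil => exact map_one _
  | cons l w ih =>
    rw [hcons, map_mul, ih, hsing]
    by_cases h : l.1 = v
    · simp [h]
    · simp only [h, if_false]
      rw [List.filter_cons_of_pos (by simpa using h), ← hcons]

/-- The support can be read off from any reduced word. -/
theorem supp_eq_wordSupp {V : Type*} {G : SimpleGraph V} (w : List (V × Bool))
    (hw : IsReducedWord G w) : supp (wordVal G w) = wordSupp w := by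
  classical
  refine Set.Subset.antisymm ?_ fun v hv => ⟨w, hw, rfl, hv⟩
  rintro v ⟨w', hw', he, ε, hv⟩
  by_contra hn
  have hk : killVertex G v (wordVal G w) = wordVal G w := by
    rw [killVertex_wordVal, List.filter_eq_self.2]
    rintro ⟨u, δ⟩ hl
    simp only [ne_eq, decide_eq_true_eq]
    rintro rfl
    exact hn ⟨δ, hl⟩
  rw [← he, killVertex_wordVal] at hk
  have hlt : (w'.filter fun l => decide (l.1 ≠ v)).length < w'.length :=
    List.length_filter_lt_length_iff_exists.2 ⟨_, hv, by simp⟩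
  exact absurd (hw' _ hk) (not_le.2 hlt)

/-- The (KK) condition: the support of the image of every vertex spans a clique. -/
def KK {V W : Type*} {L : SimpleGraph V} {G : SimpleGraph W} (ψ : RAAG L →* RAAG G) : Prop :=
  ∀ v : V, G.IsClique (supp (ψ (vert L v)))

/-- The support of a homomorphism: the union of the supports of the images of the vertices. -/
def homSupp {V W : Type*} {L : SimpleGraph V} {G : SimpleGraph W} (ψ : RAAG L →* RAAG G) :
    Set W :=
  ⋃ v : V, supp (ψ (vert L v))

end RAAG

/-- The join of a family of graphs: the disjoint union of the graphs, together with all edges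
between vertices of different members of the family. -/
def graphJoin {I : Type*} {V : I → Type*} (G : ∀ i, SimpleGraph (V i)) :
    SimpleGraph (Σ i, V i) where
  Adj x y := x.1 ≠ y.1 ∨ ∃ (i : I) (a b : V i), (G i).Adj a b ∧ x = ⟨i, a⟩ ∧ y = ⟨i, b⟩
  symm := ⟨by
    rintro x y (h | ⟨i, a, b, h, hx, hy⟩)
    · exact Or.inl h.symm
    · exact Or.inr ⟨i, b, a, h.symm, hy, hx⟩⟩
  loopless := ⟨by
    rintro x (h | ⟨i, a, b, h, hx, hy⟩)
    · exact h rfl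
    · have hab : a = b := by
        rw [hx] at hy
        simpa using hy
      exact h.ne hab⟩

/-- `L` is (isomorphic to) the join of the complements of finitely many path graphs, each on at
least one vertex. -/
def IsJoinOfPathComplements {V : Type*} (L : SimpleGraph V) : Prop :=
  ∃ (m : ℕ) (n : Fin m → ℕ), (∀ i, 1 ≤ n i) ∧
    Nonempty (L ≃g graphJoin fun i : Fin m => (SimpleGraph.pathGraph (n i))ᶜ)

/-! Let `retr G U` kill all vertices outside U, and say that U detects g if `retr G U g ≠ 1`. A
minimal detecting set is connected in the complement Γᶜ: otherwise it is a join, and its retraction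
is a product of two trivial ones (`preconnected_of_minimal`).

For a single path v_0, …, v_{n+1}, choose w so that every U detecting ψ(w) contains distinct x in
supp ψ(v_0) and y in supp ψ(v_{n+1}). Take U minimal and a geodesic from x to y in Γᶜ[U]. By (KK),
vertices adjacent in Γᶜ lie only in supports of generators that are neighbours on the path, so each
step raises the index by at most one. The geodesic thus has at least n+2 vertices, and it is an
induced path (`exists_embedding_of_detecting`). The iterated commutator of all the v_i serves as w,
except on three vertices, where commutators of v_1 with several products v_0^s v_2^t are used
(`exists_embedding_of_path`).

In a join, supports from different factors are equal or adjacent vertexwise. A vertex of a longer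
path has a non-neighbour in its own image, so it cannot coincide with a vertex of another factor.
For one-vertex factors, Hall's theorem supplies distinct images (`exists_distinct_representatives`).
-/

namespace RAAG

/-! ### Retractions, exponent sums and commutation -/

section Basic

variable {V : Type*} {G : SimpleGraph V} {H : Type*} [Group H]

/-- The universal property of a right-angled Artin group. -/
def lift (f : V → H) (hf : ∀ u v, G.Adj u v → Commute (f u) (f v)) : RAAG G →* H :=
  PresentedGroup.toGroup (f := f) (by
    rintro r ⟨a, b, hab, rfl⟩
    simp only [map_mul, map_inv, FreeGroup.lift_apply_of]
    rw [(hf a b hab).eq]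
    group)

@[simp]
theorem lift_vert (f : V → H) (hf : ∀ u v, G.Adj u v → Commute (f u) (f v)) (v : V) :
    lift f hf (vert G v) = f v :=
  PresentedGroup.toGroup.of _

theorem hom_ext {φ φ' : RAAG G →* H} (h : ∀ v, φ (vert G v) = φ' (vert G v)) : φ = φ' :=
  PresentedGroup.ext h

theorem commute_vert {u v : V} (h : G.Adj u v) : Commute (vert G u) (vert G v) := by
  have hc : vert G u * vert G v * (vert G u)⁻¹ * (vert G v)⁻¹ = 1 :=
    PresentedGroup.one_of_mem (rels := raagRels G) ⟨u, v, h, rfl⟩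
  rw [mul_inv_eq_one, mul_inv_eq_iff_eq_mul] at hc
  exact hc

theorem induction_vert {p : RAAG G → Prop} (g : RAAG G) (one : p 1) (vert : ∀ v, p (vert G v))
    (mul : ∀ x y, p x → p y → p (x * y)) (inv : ∀ x, p x → p x⁻¹) : p g := by
  have hg : g ∈ Subgroup.closure (Set.range (RAAG.vert G)) := by
    have := PresentedGroup.closure_range_of (raagRels G)
    exact this ▸ Subgroup.mem_top g
  induction hg using Subgroup.closure_induction with
  | mem x hx => obtain ⟨v, rfl⟩ := hx; exact vert v
  | one => exact one
  | mul x y _ _ hx hy => exact mul x y hx hy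
  | inv x _ hx => exact inv x hx

theorem wordVal_cons (l : V × Bool) (w : List (V × Bool)) :
    wordVal G (l :: w) = wordVal G [l] * wordVal G w := by
  simp only [wordVal]
  rw [← map_mul, FreeGroup.mul_mk, List.singleton_append]

theorem wordVal_singleton (u : V) (ε : Bool) :
    wordVal G [(u, ε)] = if ε then vert G u else (vert G u)⁻¹ := by
  cases ε
  · simp [wordVal, vert, PresentedGroup.of, FreeGroup.of, ← map_inv, FreeGroup.inv_mk,
      FreeGroup.invRev]
  · rfl

open Classical in
/-- The retraction of `A(G)` that kills the generators outside a set of vertices. -/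
noncomputable def retr (G : SimpleGraph V) (U : Set V) : RAAG G →* RAAG G :=
  lift (fun u => if u ∈ U then vert G u else 1) fun u v h => by
    split_ifs <;> first | exact commute_vert h | simp

open Classical in
theorem retr_vert (U : Set V) (u : V) :
    retr G U (vert G u) = if u ∈ U then vert G u else 1 :=
  lift_vert _ _ _

theorem retr_vert_of_mem {U : Set V} {u : V} (h : u ∈ U) : retr G U (vert G u) = vert G u := by
  rw [retr_vert, if_pos h]

theorem retr_vert_of_notMem {U : Set V} {u : V} (h : u ∉ U) : retr G U (vert G u) = 1 := by
  rw [retr_vert, if_neg h]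

theorem retr_retr (U T : Set V) (g : RAAG G) : retr G U (retr G T g) = retr G (U ∩ T) g := by
  have : (retr G U).comp (retr G T) = retr G (U ∩ T) := hom_ext fun v => by
    by_cases hT : v ∈ T <;> by_cases hU : v ∈ U <;> simp [retr_vert, hT, hU]
  exact DFunLike.congr_fun this g

open Classical in
theorem retr_wordVal (U : Set V) (w : List (V × Bool)) :
    retr G U (wordVal G w) = wordVal G (w.filter fun l => l.1 ∈ U) := by
  induction w with
  | nil => exact map_one _
  | cons l w ih =>
    obtain ⟨u, ε⟩ := l
    rw [wordVal_cons, map_mul, ih, wordVal_singleton]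
    by_cases h : u ∈ U
    · rw [List.filter_cons_of_pos (by simpa using h), wordVal_cons _ (List.filter _ w),
        wordVal_singleton]
      cases ε <;> simp [retr_vert_of_mem h]
    · rw [List.filter_cons_of_neg (by simpa using h)]
      cases ε <;> simp [retr_vert_of_notMem h]

theorem retr_eq_self_of_supp_subset {U : Set V} {g : RAAG G} (h : supp g ⊆ U) :
    retr G U g = g := by
  classical
  obtain ⟨w, hw, rfl⟩ := exists_reducedWord g
  rw [supp_eq_wordSupp w hw] at h
  rw [retr_wordVal, List.filter_eq_self.2]
  rintro ⟨u, ε⟩ hl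
  simpa using h ⟨ε, hl⟩

/-- Deleting the letters outside U from a reduced word must not shorten it. -/
theorem supp_subset_of_retr_eq_self {U : Set V} {g : RAAG G} (h : retr G U g = g) :
    supp g ⊆ U := by
  classical
  obtain ⟨w, hw, rfl⟩ := exists_reducedWord g
  rw [supp_eq_wordSupp w hw]
  rintro v ⟨ε, hv⟩
  by_contra hn
  rw [retr_wordVal] at h
  have hlt : (w.filter fun l => decide (l.1 ∈ U)).length < w.length :=
    List.length_filter_lt_length_iff_exists.2 ⟨_, hv, by simpa using hn⟩
  exact absurd (hw _ h) (not_le.2 hlt)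

theorem retr_inter_supp (U : Set V) (g : RAAG G) : retr G (U ∩ supp g) g = retr G U g := by
  rw [← retr_retr, retr_eq_self_of_supp_subset subset_rfl]

theorem retr_empty (g : RAAG G) : retr G ∅ g = 1 := by
  have : retr G ∅ = 1 := hom_ext fun v => by simp [retr_vert]
  rw [this, MonoidHom.one_apply]

theorem retr_univ (g : RAAG G) : retr G Set.univ g = g :=
  retr_eq_self_of_supp_subset (Set.subset_univ _)

theorem retr_eq_one {U : Set V} {g : RAAG G} (h : ∀ u ∈ U, u ∉ supp g) : retr G U g = 1 := by
  have he : U ∩ supp g = ∅ := Set.eq_empty_of_forall_notMem fun u hu => h u hu.1 hu.2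
  rw [← retr_inter_supp, he, retr_empty]

open Classical in
/-- The exponent sum of a generator, as a homomorphism. -/
noncomputable def expo (G : SimpleGraph V) (a : V) : RAAG G →* Multiplicative ℤ :=
  lift (fun u => if u = a then Multiplicative.ofAdd 1 else 1) fun _ _ _ => Commute.all _ _

open Classical in
theorem expo_vert (a u : V) :
    expo G a (vert G u) = if u = a then Multiplicative.ofAdd 1 else 1 :=
  lift_vert _ _ _

theorem retr_singleton (a : V) (g : RAAG G) :
    retr G {a} g = vert G a ^ (expo G a g).toAdd := by
  have : retr G {a} = ((zpowersHom (RAAG G)) (vert G a)).comp (expo G a) := hom_ext fun v => by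
    by_cases h : v = a <;> simp [retr_vert, expo_vert, h]
  rw [this]
  simp

theorem retr_eq_zpow {U : Set V} {a : V} {g : RAAG G} (ha : a ∈ U)
    (h : ∀ u ∈ U, u ∈ supp g → u = a) : retr G U g = vert G a ^ (expo G a g).toAdd := by
  rw [← retr_singleton, ← retr_inter_supp U, ← retr_inter_supp {a}]
  congr 1
  congr 1
  ext u
  constructor
  · rintro ⟨h1, h2⟩
    exact ⟨h u h1 h2, h2⟩
  · rintro ⟨rfl, h2⟩
    exact ⟨ha, h2⟩

theorem commute_retr {U : Set V} {x : RAAG G} (h : ∀ u ∈ U, Commute x (vert G u)) (g : RAAG G) :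
    Commute x (retr G U g) := by
  induction g using induction_vert with
  | one => simp
  | vert v =>
    by_cases hv : v ∈ U
    · rw [retr_vert_of_mem hv]; exact h v hv
    · rw [retr_vert_of_notMem hv]; exact Commute.one_right _
  | mul x y hx hy => rw [map_mul]; exact hx.mul_right hy
  | inv x hx => rw [map_inv]; exact hx.inv_right

theorem commute_retr_retr {U T : Set V} (h : ∀ u ∈ U, ∀ t ∈ T, G.Adj u t) (g g' : RAAG G) :
    Commute (retr G U g) (retr G T g') :=
  commute_retr (fun t ht => (commute_retr (fun u hu => (commute_vert (h u hu t ht)).symm) g).symm) g'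

/-- A retraction onto a join is the product of the retractions onto the two factors. -/
theorem retr_union {U T : Set V} (h : ∀ u ∈ U, ∀ t ∈ T, G.Adj u t) (g : RAAG G) :
    retr G (U ∪ T) g = retr G U g * retr G T g := by
  induction g using induction_vert with
  | one => simp
  | vert v =>
    by_cases hU : v ∈ U <;> by_cases hT : v ∈ T <;> simp [retr_vert, hU, hT]
    exact ((h v hU v hT).ne rfl).elim
  | mul x y hx hy =>
    rw [map_mul, map_mul, map_mul, hx, hy, mul_assoc, mul_assoc, ← mul_assoc (retr G T x),
      ← mul_assoc (retr G U y), (commute_retr_retr h y x).eq]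
  | inv x hx =>
    rw [map_inv, map_inv, map_inv, hx, mul_inv_rev, ← mul_inv_rev, ← mul_inv_rev,
      (commute_retr_retr h x x).eq]

/-- On a clique, g is a power of a times its retraction to the rest of the support; if that power is
trivial, g is supported off a. -/
theorem toAdd_expo_ne_zero {g : RAAG G} (hg : G.IsClique (supp g)) {a : V} (ha : a ∈ supp g) :
    (expo G a g).toAdd ≠ 0 := by
  intro h0
  have h1 : retr G ({a} ∪ supp g \ {a}) g = g := by
    rw [Set.union_sdiff_cancel (Set.singleton_subset_iff.2 ha)]
    exact retr_eq_self_of_supp_subset subset_rfl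
  rw [retr_union (by rintro _ rfl t ht; exact hg ha ht.1 (Ne.symm ht.2)), retr_singleton, h0,
    zpow_zero, one_mul] at h1
  exact (supp_subset_of_retr_eq_self h1 ha).2 rfl

/-- On a clique, an element with vanishing exponent sums retracts trivially. -/
theorem retr_eq_one_of_expo {T : Finset V} (hT : G.IsClique (T : Set V)) {g : RAAG G}
    (h : ∀ a ∈ T, expo G a g = 1) : retr G (T : Set V) g = 1 := by
  classical
  induction T using Finset.induction_on with
  | empty => rw [Finset.coe_empty, retr_empty]
  | insert a T ha ih =>
    rw [Finset.coe_insert, Set.insert_eq, retr_union, retr_singleton, h a (by simp), toAdd_one,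
      zpow_zero, one_mul]
    · exact ih (hT.subset (by simp)) fun b hb => h b (by simp [hb])
    · rintro _ rfl t ht
      exact hT (by simp) (by simp [Finset.mem_coe.1 ht]) (by rintro rfl; exact ha ht)

/-- Powers of two non-adjacent generators do not commute. -/
theorem not_commute_zpow {a b : V} (hab : a ≠ b) (h : ¬G.Adj a b) {p q : ℤ} (hp : p ≠ 0)
    (hq : q ≠ 0) : ¬Commute (vert G a ^ p) (vert G b ^ q) := by
  classical
  intro hc
  -- Let a act on ℚ by x ↦ x + 1 and b by x ↦ 2x. Evaluated at 0, the two products give p and 2^q p.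
  let f : V → Equiv.Perm ℚ := fun u =>
    if u = a then Equiv.addRight 1 else if u = b then MulAction.toPermHom ℚˣ ℚ (Units.mk0 2 two_ne_zero) else 1
  have hf : ∀ u v, G.Adj u v → Commute (f u) (f v) := by
    intro u v huv
    simp only [f]
    split_ifs with h1 h2 h3 h4 h5 h6
    all_goals first
      | exact Commute.refl _ | exact Commute.one_left _ | exact Commute.one_right _
      | (subst_vars; exact absurd huv h) | (subst_vars; exact absurd huv.symm h)
  have h2 := (hc.map (lift f hf)).eq
  have ea : ∀ n : ℤ, (Equiv.addRight (1 : ℚ) : Equiv.Perm ℚ) ^ n = Equiv.addRight (n : ℚ) := by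
    intro n
    simp
  have eb : ∀ (n : ℤ) (x : ℚ),
      (MulAction.toPermHom ℚˣ ℚ (Units.mk0 2 two_ne_zero) ^ n) x = 2 ^ n * x := by
    intro n x
    rw [← map_zpow]
    simp [Units.smul_def]
  rw [map_zpow, map_zpow, lift_vert, lift_vert] at h2
  simp only [f, if_true, if_neg hab.symm] at h2
  have h3 := DFunLike.congr_fun h2 0
  rw [Equiv.Perm.mul_apply, Equiv.Perm.mul_apply, eb, ea, Equiv.coe_addRight, eb] at h3
  have hp' : (p : ℚ) ≠ 0 := by exact_mod_cast hp
  have h4 : (2 : ℚ) ^ q = 1 := by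
    simp only [mul_zero, zero_add] at h3
    exact (mul_eq_right₀ hp').1 h3.symm
  rw [zpow_eq_one_iff_right₀ (by norm_num) (by norm_num)] at h4
  exact hq h4

/-- If two elements supported on cliques commute, then so do the vertices of their supports. -/
theorem eq_or_adj_of_commute {g h : RAAG G} (hg : G.IsClique (supp g)) (hh : G.IsClique (supp h))
    (hc : Commute g h) {a b : V} (ha : a ∈ supp g) (hb : b ∈ supp h) : a = b ∨ G.Adj a b := by
  by_contra! hn
  obtain ⟨hab, hadj⟩ := hn
  have h1 : retr G {a, b} g = vert G a ^ (expo G a g).toAdd := by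
    refine retr_eq_zpow (by simp) ?_
    rintro u (rfl | rfl) hu
    · rfl
    · exact absurd (hg ha hu hab) hadj
  have h2 : retr G {a, b} h = vert G b ^ (expo G b h).toAdd := by
    refine retr_eq_zpow (by simp) ?_
    rintro u (rfl | rfl) hu
    · exact absurd (hh hu hb hab) hadj
    · rfl
  have h3 := hc.map (retr G {a, b})
  rw [h1, h2] at h3
  exact not_commute_zpow hab hadj (toAdd_expo_ne_zero hg ha) (toAdd_expo_ne_zero hh hb) h3

theorem commute_vert_of_eq_or_adj {a b : V} (h : a = b ∨ G.Adj a b) :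
    Commute (vert G a) (vert G b) := by
  rcases h with rfl | h
  · exact Commute.refl _
  · exact commute_vert h

end Basic

/-! ### Induced homomorphisms -/

section Map

variable {V W : Type*} {L : SimpleGraph V} {G : SimpleGraph W}

/-- The homomorphism induced by a full embedding of graphs. -/
def map (p : L ↪g G) : RAAG L →* RAAG G :=
  lift (fun v => vert G (p v)) fun _ _ h => commute_vert (p.map_adj_iff.2 h)

theorem map_vert (p : L ↪g G) (v : V) : map p (vert L v) = vert G (p v) :=
  lift_vert _ _ _

theorem map_injective (p : L ↪g G) : Function.Injective (map p) := by
  -- Killing the vertices outside the image gives a left inverse.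
  let f : W → RAAG L := Function.extend p (vert L) 1
  have hf : ∀ u v, G.Adj u v → Commute (f u) (f v) := by
    intro u v huv
    by_cases hu : ∃ x, p x = u
    · by_cases hv : ∃ y, p y = v
      · obtain ⟨x, rfl⟩ := hu
        obtain ⟨y, rfl⟩ := hv
        simp only [f, p.injective.extend_apply]
        exact commute_vert (p.map_adj_iff.1 huv)
      · simp [f, Function.extend_apply' _ _ _ hv]
    · simp [f, Function.extend_apply' _ _ _ hu]
  have h : (lift f hf).comp (map p) = MonoidHom.id _ := hom_ext fun v => by
    simp [map_vert, f, p.injective.extend_apply]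
  exact Function.LeftInverse.injective (DFunLike.congr_fun h)

end Map

end RAAG

/-! ### Geodesics -/

namespace SimpleGraph

variable {X : Type*} {H : SimpleGraph X}

theorem Walk.dist_getVert_le {x y : X} (p : H.Walk x y) (i : ℕ) : H.dist x (p.getVert i) ≤ i :=
  (dist_le (p.take i)).trans (by rw [Walk.take_length]; exact min_le_left _ _)

theorem Walk.dist_getVert_right_le {x y : X} (p : H.Walk x y) (i : ℕ) :
    H.dist (p.getVert i) y ≤ p.length - i :=
  (dist_le (p.drop i)).trans (by rw [Walk.drop_length])

/-- A shortcut between two vertices of a geodesic would shorten the whole walk. -/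
theorem Walk.le_add_dist_getVert {x y : X} (hH : H.Connected) {p : H.Walk x y}
    (hp : p.length = H.dist x y) {i j : ℕ} (hj : j ≤ p.length) :
    j ≤ i + H.dist (p.getVert i) (p.getVert j) := by
  have h1 := hH.dist_triangle (u := x) (v := p.getVert i) (w := y)
  have h2 := hH.dist_triangle (u := p.getVert i) (v := p.getVert j) (w := y)
  have h3 := p.dist_getVert_le i
  have h4 := p.dist_getVert_right_le j
  omega

/-- A geodesic is an induced path. -/
theorem Walk.getVert_inj_of_geodesic {x y : X} (hH : H.Connected) {p : H.Walk x y}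
    (hp : p.length = H.dist x y) {i j : ℕ} (hi : i ≤ p.length) (hj : j ≤ p.length)
    (h : p.getVert i = p.getVert j) : i = j := by
  have h1 := Walk.le_add_dist_getVert hH hp (i := i) hj
  have h2 := Walk.le_add_dist_getVert hH hp (i := j) hi
  rw [h, dist_self] at h1 h2
  omega

theorem Walk.adj_getVert_iff_of_geodesic {x y : X} (hH : H.Connected) {p : H.Walk x y}
    (hp : p.length = H.dist x y) {i j : ℕ} (hi : i ≤ p.length) (hj : j ≤ p.length) :
    H.Adj (p.getVert i) (p.getVert j) ↔ i + 1 = j ∨ j + 1 = i := by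
  constructor
  · intro h
    have h1 := Walk.le_add_dist_getVert hH hp (i := i) hj
    have h2 := Walk.le_add_dist_getVert hH hp (i := j) hi
    rw [dist_eq_one_iff_adj.2 h] at h1
    rw [dist_eq_one_iff_adj.2 h.symm] at h2
    have h3 : i ≠ j := by rintro rfl; exact h.ne rfl
    omega
  · rintro (rfl | rfl)
    · exact p.adj_getVert_succ hj
    · exact (p.adj_getVert_succ hi).symm

end SimpleGraph

/-! ### Minimal detecting sets -/

namespace RAAG

open SimpleGraph

variable {W : Type*} {G : SimpleGraph W}

/-- A set of vertices that is minimal among those detecting a given element spans a connected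
subgraph of the complement. -/
theorem preconnected_of_minimal {g : RAAG G} {U : Set W}
    (hU : Minimal (fun U => retr G U g ≠ 1) U) : (Gᶜ.induce U).Preconnected := by
  intro x y
  by_contra hxy
  let T : Set W := {u | ∃ h : u ∈ U, (Gᶜ.induce U).Reachable x ⟨u, h⟩}
  have hTU : T ⊆ U := fun u hu => hu.1
  have hxT : x.1 ∈ T := ⟨x.2, Reachable.refl _⟩
  have hyT : y.1 ∉ T := fun h => hxy h.2
  have hadj : ∀ u ∈ T, ∀ t ∈ U \ T, G.Adj u t := by
    rintro u ⟨huU, hu⟩ t ⟨htU, ht⟩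
    by_contra hn
    refine ht ⟨htU, hu.trans (Adj.reachable ?_)⟩
    rw [induce_adj, compl_adj]
    refine ⟨?_, hn⟩
    rintro rfl
    exact ht ⟨htU, hu⟩
  have h1 : retr G T g = 1 := by
    by_contra h
    exact hyT (hU.2 h hTU y.2)
  have h2 : retr G (U \ T) g = 1 := by
    by_contra h
    exact (hU.2 h Set.sdiff_subset x.2).2 hxT
  apply hU.1
  rw [← Set.union_sdiff_cancel hTU, retr_union hadj, h1, h2, mul_one]

/-- Otherwise the two generators coincide or commute, and (KK) makes a and b equal or adjacent in Γ.
-/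
theorem adj_of_mem_supp {V : Type*} {L : SimpleGraph V} {ψ : RAAG Lᶜ →* RAAG G} (hKK : KK ψ)
    {i j : V} {a b : W} (ha : a ∈ supp (ψ (vert Lᶜ i))) (hb : b ∈ supp (ψ (vert Lᶜ j)))
    (hab : Gᶜ.Adj a b) : L.Adj i j := by
  rw [compl_adj] at hab
  by_contra hij
  have hne : i ≠ j := by
    rintro rfl
    exact hab.2 (hKK i ha hb hab.1)
  have hc : Commute (vert Lᶜ i) (vert Lᶜ j) := commute_vert (by simp [hne, hij])
  rcases eq_or_adj_of_commute (hKK i) (hKK j) (hc.map ψ) ha hb with h | h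
  · exact hab.1 h
  · exact hab.2 h

/-- A vertex outside supp ψ can be dropped from U without changing the retraction on the image of ψ.
-/
theorem subset_homSupp_of_minimal {V : Type*} {L : SimpleGraph V} {ψ : RAAG L →* RAAG G}
    {w : RAAG L} {U : Set W} (hU : Minimal (fun U => retr G U (ψ w) ≠ 1) U) : U ⊆ homSupp ψ := by
  intro u hu
  by_contra hn
  have h : (retr G (U \ {u})).comp ψ = (retr G U).comp ψ := hom_ext fun v => by
    have hv : u ∉ supp (ψ (vert L v)) := fun h => hn (Set.mem_iUnion.2 ⟨v, h⟩)
    rw [MonoidHom.comp_apply, MonoidHom.comp_apply, ← retr_inter_supp, ← retr_inter_supp U]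
    congr 2
    ext t
    simp only [Set.mem_inter_iff, Set.mem_sdiff, Set.mem_singleton_iff]
    constructor
    · rintro ⟨⟨h1, _⟩, h2⟩; exact ⟨h1, h2⟩
    · rintro ⟨h1, h2⟩
      refine ⟨⟨h1, ?_⟩, h2⟩
      rintro rfl
      exact hv h2
  have h' : retr G (U \ {u}) (ψ w) ≠ 1 := by
    have := DFunLike.congr_fun h w
    simp only [MonoidHom.comp_apply] at this
    rw [this]
    exact hU.1
  exact (hU.2 h' Set.sdiff_subset hu).2 rfl

/-- A path in the complement can be found from a nontrivial element such that every set of vertices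
detecting its image joins the supports of the images of the two ends. -/
theorem exists_embedding_of_detecting [Finite W] {n : ℕ}
    (ψ : RAAG (pathGraph (n + 2))ᶜ →* RAAG G) (hKK : KK ψ) (w : RAAG (pathGraph (n + 2))ᶜ)
    (hw : ψ w ≠ 1)
    (hdet : ∀ U : Set W, retr G U (ψ w) ≠ 1 → ∃ x ∈ U, ∃ y ∈ U, x ≠ y ∧
      x ∈ supp (ψ (vert _ 0)) ∧ y ∈ supp (ψ (vert _ (Fin.last (n + 1))))) :
    ∃ q : (pathGraph (n + 2))ᶜ ↪g G, Set.range q ⊆ homSupp ψ := by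
  obtain ⟨U, hU⟩ := exists_minimal_of_wellFoundedLT (fun U : Set W => retr G U (ψ w) ≠ 1)
    ⟨Set.univ, by rwa [retr_univ]⟩
  obtain ⟨x, hx, y, hy, hxy, hx0, hyn⟩ := hdet U hU.1
  have hS := subset_homSupp_of_minimal hU
  have hconn : (Gᶜ.induce U).Connected :=
    { preconnected := preconnected_of_minimal hU, nonempty := ⟨⟨x, hx⟩⟩ }
  obtain ⟨p, hp⟩ := hconn.exists_walk_length_eq_dist ⟨x, hx⟩ ⟨y, hy⟩
  have hlev : ∀ k ≤ p.length, ∃ j : Fin (n + 2), j.val ≤ k ∧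
      (p.getVert k).1 ∈ supp (ψ (vert _ j)) := by
    intro k
    induction k with
    | zero => exact fun _ => ⟨0, le_rfl, by simpa using hx0⟩
    | succ k ih =>
      intro hk
      obtain ⟨j, hj, hmem⟩ := ih (by omega)
      obtain ⟨i, hi⟩ := Set.mem_iUnion.1 (hS (p.getVert (k + 1)).2)
      have := adj_of_mem_supp hKK hmem hi (p.adj_getVert_succ hk)
      rw [pathGraph_adj] at this
      exact ⟨i, by omega, hi⟩
  -- The endpoint y may lie in several supports, so `hlev` is applied to its predecessor instead:
  -- the latter lies in a support of index at most k, and this index must be n, the only path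
  -- neighbour of n + 1.
  have hlen : n + 1 ≤ p.length := by
    have h0 : p.length ≠ 0 := by
      intro h
      exact hxy (congrArg Subtype.val (Walk.eq_of_length_eq_zero h))
    obtain ⟨k, hk⟩ := Nat.exists_eq_succ_of_ne_zero h0
    obtain ⟨j, hj, hmem⟩ := hlev k (by omega)
    have hadj := p.adj_getVert_succ (i := k) (by omega)
    rw [← Nat.succ_eq_add_one, ← hk, p.getVert_length] at hadj
    have := adj_of_mem_supp hKK hmem hyn hadj
    rw [pathGraph_adj, Fin.val_last] at this
    omega
  have hinj : ∀ i j : Fin (n + 2), (p.getVert i).1 = (p.getVert j).1 → i = j := fun i j h =>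
    Fin.ext (Walk.getVert_inj_of_geodesic hconn hp (by omega) (by omega) (Subtype.ext h))
  refine ⟨⟨⟨fun i => (p.getVert i).1, fun i j h => hinj i j h⟩, ?_⟩, ?_⟩
  · intro i j
    have := Walk.adj_getVert_iff_of_geodesic hconn hp (i := i) (j := j) (by omega) (by omega)
    rw [induce_adj, compl_adj] at this
    change G.Adj (p.getVert i).1 (p.getVert j).1 ↔ _
    rw [compl_adj, pathGraph_adj, ← this]
    constructor
    · intro h
      exact ⟨by rintro rfl; exact h.ne rfl, fun h' => h'.2 h⟩
    · rintro ⟨h1, h2⟩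
      by_contra h
      exact h2 ⟨fun h' => h1 (hinj _ _ h'), h⟩
  · rintro _ ⟨i, rfl⟩
    exact hS (p.getVert i).2

end RAAG

/-! ### Commutators that do not vanish -/

namespace RAAG

open SimpleGraph
open scoped commutatorElement

section Commutators

variable {H H' : Type*} [Group H] [Group H']

/-- The right-normed commutator `[x i, [x (i + 1), … [x (i + k - 1), x (i + k)]]]`. -/
def rightComm (x : ℕ → H) : ℕ → ℕ → H
  | i, 0 => x i
  | i, k + 1 => ⁅x i, rightComm x (i + 1) k⁆

theorem rightComm_congr {x y : ℕ → H} {i k : ℕ} (h : ∀ j, i ≤ j → j ≤ i + k → x j = y j) :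
    rightComm x i k = rightComm y i k := by
  induction k generalizing i with
  | zero => exact h i le_rfl le_rfl
  | succ k ih =>
    rw [rightComm, rightComm, h i le_rfl (by omega),
      ih fun j h1 h2 => h j (by omega) (by omega)]

theorem map_rightComm (φ : H →* H') (x : ℕ → H) (i k : ℕ) :
    φ (rightComm x i k) = rightComm (fun j => φ (x j)) i k := by
  induction k generalizing i with
  | zero => rfl
  | succ k ih => rw [rightComm, rightComm, map_commutatorElement, ih]

theorem rightComm_eq_one {x : ℕ → H} {i k j : ℕ} (h1 : i ≤ j) (h2 : j ≤ i + k) (hj : x j = 1) :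
    rightComm x i k = 1 := by
  induction k generalizing i with
  | zero => obtain rfl : j = i := by omega
            exact hj
  | succ k ih =>
    rw [rightComm]
    rcases h1.eq_or_lt with rfl | h1
    · rw [hj, commutatorElement_one_left]
    · rw [ih h1 (by omega), commutatorElement_one_right]

theorem commute_rightComm {x : ℕ → H} {g : H} {i k : ℕ}
    (h : ∀ j, i ≤ j → j ≤ i + k → Commute g (x j)) : Commute g (rightComm x i k) := by
  induction k generalizing i with
  | zero => exact h i le_rfl le_rfl
  | succ k ih =>
    have h1 := h i le_rfl (by omega)
    have h2 := ih (i := i + 1) fun j h1 h2 => h j (by omega) (by omega)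
    rw [rightComm, commutatorElement_def]
    exact ((h1.mul_right h2).mul_right h1.inv_right).mul_right h2.inv_right

/-- The left-normed commutator `[… [[g, x₁], x₂], …]`, for a list read from its end. -/
def leftComm (g : H) : List H → H
  | [] => g
  | x :: l => ⁅leftComm g l, x⁆

theorem map_leftComm (φ : H →* H') (g : H) (l : List H) :
    φ (leftComm g l) = leftComm (φ g) (l.map φ) := by
  induction l with
  | nil => rfl
  | cons x l ih => rw [List.map_cons, leftComm, leftComm, map_commutatorElement, ih]

theorem leftComm_eq_one (g : H) {l : List H} (h : (1 : H) ∈ l) : leftComm g l = 1 := by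
  induction l with
  | nil => simp at h
  | cons x l ih =>
    rw [leftComm]
    rcases List.mem_cons.1 h with rfl | h
    · rw [commutatorElement_one_right]
    · rw [ih h, commutatorElement_one_left]

end Commutators

/-- The elementary transformation adding the `j`-th coordinate to the `i`-th one. -/
def shear (i j : ℕ) (h : i ≠ j) : Equiv.Perm (ℕ → ℤ) where
  toFun f := Function.update f i (f i + f j)
  invFun f := Function.update f i (f i - f j)
  left_inv f := by simp [Function.update_of_ne h.symm]
  right_inv f := by simp [Function.update_of_ne h.symm]

theorem shear_ne_one {i j : ℕ} (h : i ≠ j) : shear i j h ≠ 1 := by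
  intro he
  have := congrFun (DFunLike.congr_fun he (fun _ => (1 : ℤ))) i
  simp [shear] at this

theorem commutator_shear {i j k : ℕ} (hij : i ≠ j) (hjk : j ≠ k) (hik : i ≠ k) :
    ⁅shear i j hij, shear j k hjk⁆ = shear i k hik := by
  rw [commutatorElement_def, mul_inv_eq_iff_eq_mul, mul_inv_eq_iff_eq_mul]
  ext f t
  simp only [shear, Equiv.Perm.mul_apply, Equiv.coe_fn_mk, Function.update_apply]
  grind

theorem commute_shear {i j k l : ℕ} (hij : i ≠ j) (hkl : k ≠ l) (hjk : j ≠ k) (hil : i ≠ l) :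
    Commute (shear i j hij) (shear k l hkl) := by
  ext f t
  simp only [shear, Equiv.Perm.mul_apply, Equiv.coe_fn_mk, Function.update_apply]
  grind

/-- The elementary-matrix relation [E_ij, E_jk] = E_ik telescopes. -/
theorem rightComm_shear (i k : ℕ) :
    rightComm (fun j => shear j (j + 1) (Nat.succ_ne_self j).symm) i k =
      shear i (i + k + 1) (by omega) := by
  induction k generalizing i with
  | zero => rfl
  | succ k ih =>
    rw [rightComm, ih, commutator_shear _ _ (by omega)]
    congr 1
    omega

/-- The generators of the group of the complement of a path, indexed by natural numbers. -/
def pathVert (n : ℕ) (k : ℕ) : RAAG (pathGraph (n + 2))ᶜ := vert _ (Fin.ofNat (n + 2) k)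

theorem rightComm_pathVert_ne_one (n : ℕ) : rightComm (pathVert n) 0 (n + 1) ≠ 1 := by
  intro h
  -- The j-th vertex acts as the elementary matrix E_{j,j+1}; those with non-consecutive indices
  -- commute.
  let f : Fin (n + 2) → Equiv.Perm (ℕ → ℤ) :=
    fun j => shear j (j + 1) (Nat.succ_ne_self j).symm
  have hf : ∀ u v, (pathGraph (n + 2))ᶜ.Adj u v → Commute (f u) (f v) := by
    intro u v huv
    rw [compl_adj, pathGraph_adj] at huv
    exact commute_shear _ _ (by omega) (by omega)
  have h1 := congrArg (lift f hf) h
  rw [map_one, map_rightComm, rightComm_congr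
    (y := fun j => shear j (j + 1) (Nat.succ_ne_self j).symm), rightComm_shear] at h1
  · exact shear_ne_one _ h1
  · intro j _ hj
    have : j % (n + 2) = j := Nat.mod_eq_of_lt (by omega)
    simp [pathVert, f, this]

/-- The affine maps `x ↦ u * x`. -/
def scaling : ℚˣ →* Equiv.Perm ℚ := MulAction.toPermHom ℚˣ ℚ

theorem scaling_apply (u : ℚˣ) (x : ℚ) : scaling u x = u * x := rfl

/-- The commutator of translation by d with scaling by u is translation by (1 - u)d. -/
theorem leftComm_scaling {c : ℚ} (hc : c ≠ 0) {l : List ℚˣ} (hl : (1 : ℚˣ) ∉ l) :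
    ∃ d : ℚ, d ≠ 0 ∧ leftComm (Equiv.addRight c : Equiv.Perm ℚ) (l.map scaling)
      = Equiv.addRight d := by
  induction l with
  | nil => exact ⟨c, hc, rfl⟩
  | cons u l ih =>
    rw [List.mem_cons, not_or] at hl
    obtain ⟨d, hd, h⟩ := ih hl.2
    refine ⟨(1 - u) * d, mul_ne_zero ?_ hd, ?_⟩
    · rw [sub_ne_zero]
      exact fun h => hl.1 (Units.ext h)
    · rw [List.map_cons, leftComm, h, commutatorElement_def, mul_inv_eq_iff_eq_mul,
        mul_inv_eq_iff_eq_mul]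
      ext x
      simp only [Equiv.Perm.mul_apply, Equiv.coe_addRight, scaling_apply]
      ring

theorem two_zpow_mul_three_zpow {s t : ℤ} (h : (2 : ℚ) ^ s * 3 ^ t = 1) : s = 0 ∧ t = 0 := by
  have : Fact (Nat.Prime 2) := ⟨Nat.prime_two⟩
  have h2 : padicValRat 2 (2 : ℚ) = 1 := padicValRat.self (by norm_num)
  have h3 : padicValRat 2 (3 : ℚ) = 0 := by
    rw [show (3 : ℚ) = ((3 : ℕ) : ℚ) by norm_num, padicValRat.of_nat,
      padicValNat.eq_zero_of_not_dvd (by norm_num)]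
    rfl
  have hs : s = 0 := by
    have := congrArg (padicValRat 2) h
    rw [padicValRat.mul (zpow_ne_zero _ (by norm_num)) (zpow_ne_zero _ (by norm_num)),
      padicValRat.zpow, padicValRat.zpow, h2, h3] at this
    simpa using this
  subst hs
  rw [zpow_zero, one_mul, zpow_eq_one_iff_right₀ (by norm_num) (by norm_num)] at h
  exact ⟨rfl, h⟩

/-- Iterated commutators of the middle vertex of a path of length two with nontrivial elements of
the free abelian group on the two end vertices are nontrivial. -/
theorem leftComm_pathThree_ne_one {l : List (ℤ × ℤ)} (hl : ((0, 0) : ℤ × ℤ) ∉ l) :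
    leftComm (vert (pathGraph 3)ᶜ 1)
      (l.map fun c => vert (pathGraph 3)ᶜ 0 ^ c.1 * vert (pathGraph 3)ᶜ 2 ^ c.2) ≠ 1 := by
  intro h
  let u2 : ℚˣ := Units.mk0 2 two_ne_zero
  let u3 : ℚˣ := Units.mk0 3 three_ne_zero
  let f : Fin 3 → Equiv.Perm ℚ := ![scaling u2, Equiv.addRight 1, scaling u3]
  have hf : ∀ u v, (pathGraph 3)ᶜ.Adj u v → Commute (f u) (f v) := by
    intro u v huv
    have hc : Commute (scaling u2) (scaling u3) := (Commute.all u2 u3).map scaling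
    rw [compl_adj, pathGraph_adj] at huv
    fin_cases u <;> fin_cases v <;> simp at huv
    · exact hc
    · exact hc.symm
  have h1 := congrArg (lift f hf) h
  rw [map_one, map_leftComm, List.map_map] at h1
  have h2 : (lift f hf) ∘ (fun c : ℤ × ℤ => vert (pathGraph 3)ᶜ 0 ^ c.1 * vert (pathGraph 3)ᶜ 2 ^ c.2)
      = scaling ∘ fun c : ℤ × ℤ => u2 ^ c.1 * u3 ^ c.2 := by
    funext c
    simp only [Function.comp_apply, map_mul, map_zpow, lift_vert]
    rfl
  rw [h2, ← List.map_map, lift_vert] at h1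
  have h3 : (1 : ℚˣ) ∉ l.map fun c : ℤ × ℤ => u2 ^ c.1 * u3 ^ c.2 := by
    intro hm
    obtain ⟨⟨s, t⟩, hc, he⟩ := List.mem_map.1 hm
    have he' := congrArg Units.val he
    simp only [Units.val_mul, Units.val_zpow_eq_zpow_val, Units.val_one] at he'
    obtain ⟨rfl, rfl⟩ := two_zpow_mul_three_zpow he'
    exact hl hc
  obtain ⟨d, hd, he⟩ := leftComm_scaling one_ne_zero h3
  have h4 := DFunLike.congr_fun (he.symm.trans h1) 0
  simp at h4
  exact hd h4

/-! ### A single path -/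

variable {W : Type*} {G : SimpleGraph W}

/-- The last three alternatives are the ways in which the ends can fail to be separated; the choice
of w must rule out each of them. -/
theorem exists_ne_or_forall_eq (S T U : Set W) :
    (∃ x ∈ U, ∃ y ∈ U, x ≠ y ∧ x ∈ S ∧ y ∈ T) ∨ (∀ u ∈ U, u ∉ S) ∨ (∀ u ∈ U, u ∉ T) ∨
      ∃ a ∈ U, a ∈ S ∧ a ∈ T ∧ (∀ u ∈ U, u ∈ S → u = a) ∧ ∀ u ∈ U, u ∈ T → u = a := by
  by_contra! h
  obtain ⟨h1, ⟨a, ha, haS⟩, ⟨b, hb, hbT⟩, h4⟩ := h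
  obtain rfl : a = b := by
    by_contra hab
    exact h1 a ha b hb hab haS hbT
  obtain ⟨u, hu, huT, hne⟩ := h4 a ha haS hbT fun u hu huS => by
    by_contra hne
    exact h1 u hu a ha hne huS hbT
  exact h1 a ha u hu hne.symm haS huT

/-- The theorem for a single path on at least two vertices. -/
theorem exists_embedding_of_path [Finite W] {n : ℕ} (ψ : RAAG (pathGraph (n + 2))ᶜ →* RAAG G)
    (hinj : Function.Injective ψ) (hKK : KK ψ) :
    ∃ q : (pathGraph (n + 2))ᶜ ↪g G, Set.range q ⊆ homSupp ψ := by
  rcases eq_or_ne n 1 with rfl | hn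
  · classical
    have := Fintype.ofFinite W
    let e : Fin 3 → W → ℤ := fun i a => (expo G a (ψ (vert _ i))).toAdd
    -- Each pair (s, t) stands for v_0^s v_2^t. The first two pairs vanish when U misses an end
    -- support. If U meets both in a alone, the pair for a retracts to a^(e_0 e_2 - e_2 e_0) = 1.
    -- The filter keeps (0, 0) out.
    let l : List (ℤ × ℤ) := (1, 0) :: (0, 1) ::
      ((Finset.univ.filter fun a => e 0 a ≠ 0).toList.map fun a => (e 2 a, - e 0 a))
    have hl : ((0, 0) : ℤ × ℤ) ∉ l := by
      simp +contextual [l]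
    refine exists_embedding_of_detecting ψ hKK _
      ((map_ne_one_iff ψ hinj).2 (leftComm_pathThree_ne_one hl)) fun U hU => ?_
    have hdead : ∀ c ∈ l, retr G U (ψ (vert _ 0)) ^ c.1 * retr G U (ψ (vert _ 2)) ^ c.2 ≠ 1 := by
      intro c hc h
      apply hU
      rw [map_leftComm, map_leftComm, List.map_map, List.map_map]
      apply leftComm_eq_one
      refine List.mem_map.2 ⟨c, hc, ?_⟩
      simpa using h
    rcases exists_ne_or_forall_eq (supp (ψ (vert _ 0))) (supp (ψ (vert _ 2))) U
      with h | h | h | ⟨a, ha, ha0, ha2, h0, h2⟩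
    · exact h
    · exact absurd (by simp [retr_eq_one h]) (hdead (1, 0) (by simp [l]))
    · exact absurd (by simp [retr_eq_one h]) (hdead (0, 1) (by simp [l]))
    · refine absurd ?_ (hdead (e 2 a, - e 0 a) ?_)
      · rw [retr_eq_zpow ha h0, retr_eq_zpow ha h2, ← zpow_mul, ← zpow_mul, ← zpow_add]
        simp only [e]
        rw [mul_neg, mul_comm, add_neg_cancel, zpow_zero]
      · have : e 0 a ≠ 0 := toAdd_expo_ne_zero (hKK 0) ha0
        simp only [l, List.mem_cons]
        exact Or.inr (Or.inr (List.mem_map.2 ⟨a, by simpa using this, rfl⟩))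
  · refine exists_embedding_of_detecting ψ hKK _
      ((map_ne_one_iff ψ hinj).2 (rightComm_pathVert_ne_one n)) fun U hU => ?_
    rw [map_rightComm, map_rightComm] at hU
    have hlast : pathVert n (n + 1) = vert _ (Fin.last (n + 1)) := by
      rw [pathVert]
      congr 1
      exact Fin.ext (Nat.mod_eq_of_lt (by omega))
    have hzero : pathVert n 0 = vert _ 0 := rfl
    rcases exists_ne_or_forall_eq (supp (ψ (vert _ 0))) (supp (ψ (vert _ (Fin.last (n + 1))))) U
      with h | h | h | ⟨a, ha, ha0, ha2, h0, h2⟩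
    · exact h
    · exact absurd (rightComm_eq_one (j := 0) le_rfl (by omega)
        (by rw [hzero, retr_eq_one h])) hU
    · exact absurd (rightComm_eq_one (j := n + 1) (by omega) (by omega)
        (by rw [hlast, retr_eq_one h])) hU
    · refine absurd ?_ hU
      rw [rightComm, commutatorElement_eq_one_iff_commute]
      -- Only v_1 needs an argument, since later vertices commute with v_0 already. If n = 0, v_1 is
      -- the last vertex and also retracts to a power of a. If n ≥ 2, v_1 commutes with v_{n+1},
      -- whose support contains a; this is where n = 1 fails.
      refine commute_rightComm fun j hj1 hj2 => ?_
      have hj : pathVert n j = vert _ ⟨j, by omega⟩ := by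
        rw [pathVert]
        congr 1
        exact Fin.ext (Nat.mod_eq_of_lt (by omega))
      rw [hzero, hj]
      rcases hj1.eq_or_lt with rfl | hj1
      · rw [retr_eq_zpow ha h0]
        apply Commute.zpow_left
        rcases Nat.eq_zero_or_pos n with rfl | hn0
        · rw [show (⟨0 + 1, by omega⟩ : Fin (0 + 2)) = Fin.last (0 + 1) from rfl,
            retr_eq_zpow ha h2]
          exact (Commute.refl _).zpow_right _
        · rw [← retr_inter_supp]
          refine commute_retr (fun u hu => commute_vert_of_eq_or_adj ?_) _
          by_contra! hau
          have hadj := adj_of_mem_supp hKK ha2 hu.2 ((compl_adj _ _ _).2 hau)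
          rw [pathGraph_adj, Fin.val_last] at hadj
          simp at hadj
          omega
      · refine ((commute_vert ?_).map ψ).map (retr G U)
        rw [compl_adj, pathGraph_adj]
        refine ⟨fun h => ?_, ?_⟩
        · have := congrArg Fin.val h
          simp at this
          omega
        · simp
          omega

end RAAG

/-! ### Distinct representatives -/

namespace RAAG

open SimpleGraph

variable {V W : Type*} {L : SimpleGraph V} {G : SimpleGraph W}

theorem toAdd_expo_prod {ι : Type*} (s : Finset ι) (x : ι → RAAG G) (c : ι → ℤ) (b : W) :
    (expo G b (s.toList.map fun i => x i ^ c i).prod).toAdd =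
      ∑ i ∈ s, c i * (expo G b (x i)).toAdd := by
  rw [map_list_prod, List.map_map, Finset.prod_map_toList, toAdd_prod]
  simp

/-- The images of pairwise commuting generators under an injective homomorphism have a system of
distinct representatives in their supports. -/
theorem exists_distinct_representatives [Finite W] {ψ : RAAG L →* RAAG G}
    (hinj : Function.Injective ψ) (hKK : KK ψ) {ι : Type*} {z : ι → V}
    (hz : ∀ i j, i ≠ j → L.Adj (z i) (z j)) :
    ∃ a : ι → W, Function.Injective a ∧ ∀ i, a i ∈ supp (ψ (vert L (z i))) := by
  classical
  let t : ι → Finset W := fun i => (Set.toFinite (supp (ψ (vert L (z i))))).toFinset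
  have ht : ∀ i b, b ∈ t i ↔ b ∈ supp (ψ (vert L (z i))) := fun i b => Set.Finite.mem_toFinset _
  -- Hall's condition. If it fails for s, more than |T| commuting generators map into the free
  -- abelian group on a clique T.
  suffices h : ∀ s : Finset ι, s.card ≤ (s.biUnion t).card by
    obtain ⟨a, ha, hat⟩ := (Finset.all_card_le_biUnion_card_iff_exists_injective t).1 h
    exact ⟨a, ha, fun i => (ht i _).1 (hat i)⟩
  intro s
  by_contra! hlt
  let T := s.biUnion t
  have hT : G.IsClique (T : Set W) := by
    intro b hb b' hb' hne
    obtain ⟨i, _, hi⟩ := Finset.mem_biUnion.1 hb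
    obtain ⟨j, _, hj⟩ := Finset.mem_biUnion.1 hb'
    rw [ht] at hi hj
    rcases eq_or_ne i j with rfl | hij
    · exact hKK _ hi hj hne
    · exact (eq_or_adj_of_commute (hKK _) (hKK _) ((commute_vert (hz i j hij)).map ψ) hi
        hj).resolve_left hne
  -- With fewer rows than columns, M has a nonzero integer kernel vector c. Then ψ kills the product
  -- of the z_i^(c_i), so injectivity and the exponent sums in L force c = 0.
  let M : Matrix T s ℤ := fun b i => (expo G b.1 (ψ (vert L (z i)))).toAdd
  have hM : ¬Function.Injective M.mulVecLin := by
    intro h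
    have := LinearMap.finrank_le_finrank_of_injective h
    simp only [Module.finrank_fintype_fun_eq_card, Fintype.card_coe] at this
    exact absurd this (not_le.2 hlt)
  rw [injective_iff_map_eq_zero] at hM
  push Not at hM
  obtain ⟨c, hc, hc0⟩ := hM
  apply hc0
  let g : RAAG L := ((Finset.univ : Finset s).toList.map fun i : s => vert L (z i) ^ c i).prod
  have hψg : ψ g = ((Finset.univ : Finset s).toList.map fun i : s => ψ (vert L (z i)) ^ c i).prod := by
    rw [map_list_prod, List.map_map]
    congr 2
    funext i
    simp
  have hretr : retr G (T : Set W) (ψ g) = ψ g := by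
    rw [hψg, map_list_prod, List.map_map]
    congr 2
    funext i
    rw [Function.comp_apply, map_zpow, retr_eq_self_of_supp_subset]
    intro b hb
    exact Finset.mem_coe.2 (Finset.mem_biUnion.2 ⟨i, i.2, (ht i b).2 hb⟩)
  have hg : g = 1 := by
    rw [← map_eq_one_iff ψ hinj, ← hretr]
    refine retr_eq_one_of_expo hT fun b hb => ?_
    apply Multiplicative.toAdd.injective
    rw [hψg, toAdd_expo_prod, toAdd_one]
    have : ∑ i, M ⟨b, hb⟩ i * c i = 0 := congrFun hc ⟨b, hb⟩
    simpa only [M, mul_comm] using this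
  funext j
  have h1 := congrArg (fun x => (expo L (z j) x).toAdd) hg
  simp only [g, toAdd_expo_prod, map_one, toAdd_one] at h1
  rw [Finset.sum_eq_single j] at h1
  · simpa [expo_vert] using h1
  · intro i _ hij
    have hne : z i ≠ z j := (hz i j fun h => hij (Subtype.ext h)).ne
    simp [expo_vert, hne]
  · simp

theorem homSupp_comp_map_subset {U : Type*} {K : SimpleGraph U} (ψ : RAAG L →* RAAG G)
    (p : K ↪g L) : homSupp (ψ.comp (map p)) ⊆ homSupp ψ :=
  Set.iUnion_subset fun v => by
    rw [MonoidHom.comp_apply, map_vert]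
    exact Set.subset_iUnion (fun v => supp (ψ (vert L v))) (p v)

end RAAG

/-! ### Assembling the join -/

open RAAG SimpleGraph

/-- The inclusion of a member of a family of graphs into the join. -/
def graphJoinEmbedding {I : Type*} {V : I → Type*} (G : ∀ i, SimpleGraph (V i)) (i : I) :
    G i ↪g graphJoin G where
  toFun := Sigma.mk i
  inj' := sigma_mk_injective
  map_rel_iff' {a b} := by
    constructor
    · rintro (h | ⟨j, a', b', h, h1, h2⟩)
      · exact absurd rfl h
      · cases h1
        cases h2
        exact h
    · exact fun h => Or.inr ⟨i, a, b, h, rfl, rfl⟩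

/-- A family of full embeddings with disjoint images that are completely joined to each other
extends to the join. -/
theorem exists_graphJoin_embedding {I W : Type*} {V : I → Type*} {K : ∀ i, SimpleGraph (V i)}
    {G : SimpleGraph W} (q : ∀ i, K i ↪g G)
    (hq : ∀ i j, i ≠ j → ∀ a b, G.Adj (q i a) (q j b)) :
    ∃ ι : graphJoin K ↪g G, ∀ i a, ι ⟨i, a⟩ = q i a := by
  refine ⟨⟨⟨fun x => q x.1 x.2, ?_⟩, ?_⟩, fun i a => rfl⟩
  · rintro ⟨i, a⟩ ⟨j, b⟩ h
    rcases eq_or_ne i j with rfl | hij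
    · exact congrArg (Sigma.mk i) ((q i).injective h)
    · exact absurd h (hq i j hij a b).ne
  · rintro ⟨i, a⟩ ⟨j, b⟩
    change G.Adj (q i a) (q j b) ↔ _
    rcases eq_or_ne i j with rfl | hij
    · rw [(q i).map_adj_iff]
      exact (graphJoinEmbedding K i).map_adj_iff.symm
    · exact ⟨fun _ => Or.inl hij, fun _ => hq i j hij a b⟩

theorem exists_pathGraph_adj {n : ℕ} (hn : n ≠ 1) (a : Fin n) : ∃ b, (pathGraph n).Adj a b := by
  have ha := a.2
  rcases Nat.eq_zero_or_pos a.1 with h | h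
  · exact ⟨⟨a + 1, by omega⟩, by rw [pathGraph_adj]; simp⟩
  · exact ⟨⟨a - 1, by omega⟩, by rw [pathGraph_adj]; simp; omega⟩

theorem lemma4p5 {V W : Type*} [Finite W] (L : SimpleGraph V) (G : SimpleGraph W)
    (hL : IsJoinOfPathComplements L) (ψ : RAAG L →* RAAG G)
    (hinj : Function.Injective ψ) (hKK : RAAG.KK ψ) :
    ∃ ι : L ↪g G, Set.range ι ⊆ RAAG.homSupp ψ := by
  obtain ⟨m, n, hn, ⟨e⟩⟩ := hL
  let K : ∀ i : Fin m, SimpleGraph (Fin (n i)) := fun i => (pathGraph (n i))ᶜ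
  let p : ∀ i, K i ↪g L := fun i => (graphJoinEmbedding K i).trans e.symm.toEmbedding
  have hp : ∀ i j, i ≠ j → ∀ a b, L.Adj (p i a) (p j b) := fun i j hij a b =>
    e.symm.map_adj_iff.2 (Or.inl hij)
  have hcross : ∀ i j, i ≠ j → ∀ x ∈ homSupp (ψ.comp (RAAG.map (p i))),
      ∀ y ∈ homSupp (ψ.comp (RAAG.map (p j))), x = y ∨ G.Adj x y := by
    intro i j hij x hx y hy
    obtain ⟨a, ha⟩ := Set.mem_iUnion.1 hx
    obtain ⟨b, hb⟩ := Set.mem_iUnion.1 hy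
    rw [MonoidHom.comp_apply, map_vert] at ha hb
    exact eq_or_adj_of_commute (hKK _) (hKK _) ((commute_vert (hp i j hij a b)).map ψ) ha hb
  obtain ⟨r, hr, hrs⟩ := exists_distinct_representatives hinj hKK
    (z := fun i : {i // n i = 1} => p i.1 ⟨0, hn i.1⟩)
    fun i j hij => hp _ _ (fun h => hij (Subtype.ext h)) _ _
  have hq : ∀ i, ∃ q : K i ↪g G, Set.range q ⊆ homSupp (ψ.comp (RAAG.map (p i))) ∧
      ∀ (h : n i = 1) a, q a = r ⟨i, h⟩ := by
    intro i
    by_cases h : n i = 1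
    · have hsub : Subsingleton (Fin (n i)) := by rw [h]; infer_instance
      refine ⟨⟨⟨fun _ => r ⟨i, h⟩, fun a b _ => Subsingleton.elim a b⟩, ?_⟩, ?_, fun _ _ => rfl⟩
      · intro a b
        rw [Subsingleton.elim a b]
        simp
      · rintro _ ⟨a, rfl⟩
        refine Set.mem_iUnion.2 ⟨⟨0, hn i⟩, ?_⟩
        rw [MonoidHom.comp_apply, map_vert]
        exact hrs ⟨i, h⟩
    · have hKK' : KK (ψ.comp (RAAG.map (p i))) := fun v => by
        rw [MonoidHom.comp_apply, map_vert]
        exact hKK _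
      have hinj' : Function.Injective (ψ.comp (RAAG.map (p i))) :=
        hinj.comp (map_injective (p i))
      have hi := hn i
      obtain ⟨k, hk⟩ : ∃ k, n i = k + 2 := ⟨n i - 2, by omega⟩
      have key : ∀ {N : ℕ} (φ : RAAG (pathGraph N)ᶜ →* RAAG G), N = k + 2 →
          Function.Injective φ → KK φ → ∃ q : (pathGraph N)ᶜ ↪g G, Set.range q ⊆ homSupp φ := by
        rintro _ φ rfl h1 h2
        exact exists_embedding_of_path φ h1 h2
      obtain ⟨q, hq⟩ := key _ hk hinj' hKK'
      exact ⟨q, hq, fun h' => absurd h' h⟩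
  choose q hqs hqr using hq
  -- For a path neighbour a' of a, the image of a' is distinct from and non-adjacent to that of a,
  -- whereas across factors support vertices are equal or adjacent.
  have hne : ∀ i j, i ≠ j → n i ≠ 1 → ∀ a b, q i a ≠ q j b := by
    intro i j hij hi a b h
    obtain ⟨a', ha'⟩ := exists_pathGraph_adj hi a
    have h1 : ¬G.Adj (q i a') (q i a) := by
      rw [(q i).map_adj_iff, compl_adj]
      exact fun h' => h'.2 ha'.symm
    rcases hcross i j hij _ (hqs i ⟨a', rfl⟩) _ (hqs j ⟨b, rfl⟩) with h2 | h2
    · exact ha'.ne ((q i).injective (h.trans h2.symm))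
    · exact h1 (h ▸ h2)
  obtain ⟨ι, hι⟩ := exists_graphJoin_embedding q fun i j hij a b => by
    refine (hcross i j hij _ (hqs i ⟨a, rfl⟩) _ (hqs j ⟨b, rfl⟩)).resolve_left fun h => ?_
    by_cases hi : n i = 1
    · by_cases hj : n j = 1
      · rw [hqr i hi, hqr j hj] at h
        exact hij (congrArg Subtype.val (hr h))
      · exact hne j i hij.symm hj b a h.symm
    · exact hne i j hij hi a b h
  refine ⟨e.toEmbedding.trans ι, ?_⟩
  rintro _ ⟨v, rfl⟩
  have h := hι (e v).1 (e v).2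
  change ι (e v) ∈ _
  rw [show ι (e v) = q (e v).1 (e v).2 from h]
  exact homSupp_comp_map_subset ψ _ (hqs _ ⟨_, rfl⟩)
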